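/- Let $(T_n)_{n\ge 0}$ be the Tribonacci numbers, $T_0=0$, $T_1=T_2=1$, $T_n=T_{n-1}+T_{n-2}+T_{n-3}$ for $n\ge 3$, and let $\mathbf T=0102010010201\cdots$ be the infinite Tribonacci word, that is, the fixed point, starting with $0$, of the morphism $0\mapsto 01$, $1\mapsto 02$, $2\mapsto 0$. A finite word $w=w[0]\cdots w[m-1]$ has period $p\ge 1$ if $w[i]=w[i+p]$ for all $i\ge 0$ with $i+p<m$. The exponent of $w$ is its length divided by its smallest period, and the critical exponent of an infinite word is the supremum of the exponents of its factors (finite blocks of consecutive letters). Then: (a) The polynomial $2x^3-12x^2+22x-13$ has exactly one real zero $\rho$, with $\rho = 3.19148788395311874706$ to 20 decimal places (error less than $\tfrac12\cdot 10^{-20}$), and the critical exponent of $\mathbf T$ equals $\rho$. (b) For every $j\ge 2$ there is a longest factor of $\mathbf T$ having period $T_j$ (not necessarily as its smallest period), and its length is $$U_j=\tfrac52 T_j+T_{j-1}+\tfrac12 T_{j-2}-\tfrac32 .$$ (c) $\lim_{j\to\infty} U_j/T_j=\rho$. -/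

import Mathlib

open Filter Topology

namespace Tribonacci

/-- The Tribonacci numbers `0, 1, 1, 2, 4, 7, 13, 24, …`. -/
def tribNum : ℕ → ℕ
  | 0 => 0
  | 1 => 1
  | 2 => 1
  | n + 3 => tribNum (n + 2) + tribNum (n + 1) + tribNum n

/-- The images of the letters under the Tribonacci morphism `0 ↦ 01`, `1 ↦ 02`, `2 ↦ 0`. -/
def letterImage : Fin 3 → List (Fin 3)
  | 0 => [0, 1]
  | 1 => [0, 2]
  | 2 => [0]

/-- The Tribonacci morphism on finite words. -/
def morphism (w : List (Fin 3)) : List (Fin 3) := w.flatMap letterImage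

/-- The word obtained by applying the morphism `n` times to the one-letter word `0`. -/
def iter : ℕ → List (Fin 3)
  | 0 => [0]
  | n + 1 => morphism (iter n)

theorem morphism_append (u v : List (Fin 3)) :
    morphism (u ++ v) = morphism u ++ morphism v := by
  simp [morphism]

theorem iter_succ_eq (n : ℕ) :
    ∃ a v, iter (n + 1) = iter n ++ a :: v := by
  induction n with
  | zero => exact ⟨1, [], by decide⟩
  | succ n ih =>
    obtain ⟨a, v, h⟩ := ih
    have h2 : iter (n + 1 + 1) = iter (n + 1) ++ (letterImage a ++ morphism v) := by
      change morphism (iter (n + 1)) = _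
      rw [h, morphism_append, ← h]
      simp [iter, morphism]
    fin_cases a
    · exact ⟨0, [1] ++ morphism v, by simpa [letterImage] using h2⟩
    · exact ⟨0, [2] ++ morphism v, by simpa [letterImage] using h2⟩
    · exact ⟨0, morphism v, by simpa [letterImage] using h2⟩

theorem lt_length_iter (n : ℕ) : n < (iter n).length := by
  induction n with
  | zero => decide
  | succ n ih =>
    obtain ⟨a, v, h⟩ := iter_succ_eq n
    rw [h, List.length_append, List.length_cons]
    omega

/-- The infinite Tribonacci word `0102010010201⋯`, the fixed point of the morphism that starts
with `0`: each word `iter n` is a proper prefix of `iter (n + 1)` (`iter_succ_eq`), and the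
infinite word is their limit. -/
def tribWord (i : ℕ) : Fin 3 := (iter i)[i]'(lt_length_iter i)

theorem iter_prefix {m n : ℕ} (h : m ≤ n) : iter m <+: iter n := by
  induction n, h using Nat.le_induction with
  | base => exact List.prefix_refl _
  | succ n _ ih =>
    obtain ⟨a, v, hv⟩ := iter_succ_eq n
    exact ih.trans ⟨a :: v, hv.symm⟩

/-- Every word `iter n` is a prefix of the infinite Tribonacci word. -/
theorem tribWord_eq_getElem (n i : ℕ) (h : i < (iter n).length) :
    tribWord i = (iter n)[i] := by
  rcases le_total i n with hin | hin
  · exact (iter_prefix hin).getElem (lt_length_iter i)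
  · exact ((iter_prefix hin).getElem h).symm

section Words

variable {A : Type*}

/-- `w` is a factor (a finite block of consecutive letters) of the infinite word `x`. -/
def IsFactor (w : List A) (x : ℕ → A) : Prop :=
  ∃ i n : ℕ, w = List.ofFn (fun k : Fin n => x (i + k))

/-- `p ≥ 1` is a period of the finite word `w`: `w[i] = w[i + p]` whenever both sides make
sense. -/
def HasPeriod (w : List A) (p : ℕ) : Prop :=
  0 < p ∧ ∀ (i : ℕ) (h : i + p < w.length), w[i] = w[i + p]

/-- Every finite word has a period, so its smallest period is well defined. -/
theorem exists_hasPeriod (w : List A) : ∃ p, HasPeriod w p :=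
  ⟨w.length + 1, Nat.succ_pos _, fun i h => absurd h (by omega)⟩

open Classical in
/-- The smallest period of a finite word. -/
noncomputable def smallestPeriod (w : List A) : ℕ := Nat.find (exists_hasPeriod w)

/-- The exponent of a finite word: its length divided by its smallest period. -/
noncomputable def exponent (w : List A) : ℝ := (w.length : ℝ) / (smallestPeriod w : ℝ)

/-- The critical exponent of an infinite word: the supremum of the exponents of its factors
(in the extended reals, since it can be infinite). -/
noncomputable def criticalExponent (x : ℕ → A) : EReal :=
  sSup {e : EReal | ∃ w : List A, IsFactor w x ∧ e = (exponent w : EReal)}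

end Words

end Tribonacci

namespace Tribonacci

open Finset

/-! ### Desubstitution of the Tribonacci word -/

/-! A factor of length `p + r` with period `p` is a pair of equal blocks of length `r` at distance
`p` (`Agree`). If it extends neither way and `r > 0`, both blocks start at images of letters and
arise from a shorter maximal pair by applying the morphism and appending the next `0`. Descending to
an empty pair after `n` steps (`exists_of_maximal`), the appended zeros give `r = T_2 + ⋯ +
T_{n+1}`, while `p` is at least the length `T_{n+1}` of the shortest `n`-fold image of a letter.
Lifting the empty pair around a letter `2` attains both values (`exists_agree_tribNum`). Hence `2
U_j + 3 = T_{j+2} + 3 T_j`. With `τ` the real root of `x³ = x² + x + 1`, `|T_{j+2} - τ² T_j| ≤ 3`,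
so `U_j ≤ ρ T_j` and `U_j / T_j → ρ = (3 + τ²) / 2`. -/

/-- The length of the image under the morphism of the prefix of length `m` of the Tribonacci
word. -/
def cut : ℕ → ℕ
  | 0 => 0
  | m + 1 => cut m + (letterImage (tribWord m)).length

theorem length_letterImage (a : Fin 3) :
    (letterImage a).length = if a = 2 then 1 else 2 := by
  fin_cases a <;> rfl

theorem cut_succ (m : ℕ) : cut (m + 1) = cut m + if tribWord m = 2 then 1 else 2 := by
  rw [cut, length_letterImage]

theorem cut_lt_succ (m : ℕ) : cut m < cut (m + 1) := by
  rw [cut_succ]; split_ifs <;> omega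

theorem cut_strictMono : StrictMono cut := strictMono_nat_of_lt_succ cut_lt_succ

theorem cut_add_le (m k : ℕ) : cut m + k ≤ cut (m + k) := by
  have := cut_strictMono.add_le_nat k m
  rw [add_comm m k]
  omega

theorem length_morphism_take (n m : ℕ) (h : m ≤ (iter n).length) :
    (morphism ((iter n).take m)).length = cut m := by
  induction m with
  | zero => simp [morphism, cut]
  | succ m ih =>
    rw [← List.take_append_getElem (show m < (iter n).length by omega), morphism_append,
      List.length_append, ih (by omega), ← tribWord_eq_getElem n m (by omega)]
    simp [morphism, cut]

theorem tribWord_cut_add (m k : ℕ) (h : k < (letterImage (tribWord m)).length) :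
    tribWord (cut m + k) = (letterImage (tribWord m))[k] := by
  have hm := lt_length_iter m
  have hsplit : iter (m + 1) = morphism ((iter m).take m) ++
      (letterImage (tribWord m) ++ morphism ((iter m).drop (m + 1))) := by
    have h1 : iter m = (iter m).take m ++ (tribWord m :: (iter m).drop (m + 1)) := by
      rw [tribWord, List.getElem_cons_drop, List.take_append_drop]
    change morphism (iter m) = _
    conv_lhs => rw [h1]
    rw [morphism_append]
    simp [morphism]
  have hlen := length_morphism_take m m hm.le
  have hlt : cut m + k < (iter (m + 1)).length := by
    rw [hsplit, List.length_append, List.length_append, hlen]; omega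
  rw [tribWord_eq_getElem (m + 1) _ hlt]
  simp only [hsplit]
  rw [List.getElem_append_right (by omega), List.getElem_append_left (by omega)]
  simp [hlen]

theorem tribWord_cut (m : ℕ) : tribWord (cut m) = 0 := by
  have h := tribWord_cut_add m 0 (by rw [length_letterImage]; split_ifs <;> omega)
  rw [add_zero] at h
  rw [h]
  generalize tribWord m = a
  fin_cases a <;> rfl

/-- The letter `2` fits the pattern because its image is just `0`: the next letter is the `0`
opening the following image, and `2 + 1 = 0` in `Fin 3`. -/
theorem tribWord_cut_succ (m : ℕ) : tribWord (cut m + 1) = tribWord m + 1 := by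
  by_cases hm : tribWord m = 2
  · have h := tribWord_cut (m + 1)
    rw [cut_succ, if_pos hm] at h
    rw [h, hm]; rfl
  · rw [tribWord_cut_add m 1 (by rw [length_letterImage, if_neg hm]; omega)]
    revert hm
    generalize tribWord m = a
    fin_cases a <;> simp [letterImage]

theorem exists_cut_le (j : ℕ) : ∃ m, cut m ≤ j ∧ j < cut (m + 1) := by
  induction j with
  | zero => exact ⟨0, le_rfl, cut_lt_succ 0⟩
  | succ j ih =>
    obtain ⟨m, h1, h2⟩ := ih
    rcases (show j + 1 ≤ cut (m + 1) from h2).lt_or_eq with h | h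
    · exact ⟨m, by omega, h⟩
    · exact ⟨m + 1, h.ge, h ▸ cut_lt_succ (m + 1)⟩

theorem exists_eq_cut_or (j : ℕ) :
    (∃ m, j = cut m) ∨ ∃ m, j = cut m + 1 ∧ tribWord j ≠ 0 := by
  obtain ⟨m, h1, h2⟩ := exists_cut_le j
  rcases h1.eq_or_lt with h | h
  · exact Or.inl ⟨m, h.symm⟩
  · rw [cut_succ] at h2
    split_ifs at h2 with hm
    · omega
    · have hj : j = cut m + 1 := by omega
      refine Or.inr ⟨m, hj, ?_⟩
      rw [hj, tribWord_cut_succ]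
      revert hm
      generalize tribWord m = a
      fin_cases a <;> decide

theorem exists_eq_cut {j : ℕ} (hj : tribWord j = 0) : ∃ m, j = cut m :=
  (exists_eq_cut_or j).resolve_right fun ⟨_, _, h⟩ => h hj

theorem tribWord_pred {j : ℕ} (hj : tribWord j ≠ 0) : ∃ i, j = i + 1 ∧ tribWord i = 0 := by
  rcases exists_eq_cut_or j with ⟨m, rfl⟩ | ⟨m, rfl, -⟩
  · exact absurd (tribWord_cut m) hj
  · exact ⟨cut m, rfl, tribWord_cut m⟩

theorem tribWord_succ {j : ℕ} (hj : tribWord j ≠ 0) : tribWord (j + 1) = 0 := by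
  by_contra h
  obtain ⟨i, hi, h0⟩ := tribWord_pred h
  obtain rfl : j = i := by omega
  exact hj h0

/-! ### Lengths of iterated images -/

/-- The increments of `cut^[k]` are the lengths of the `k`-fold images of the letters. -/
theorem cut_iterate_succ (k : ℕ) : ∀ m,
    (tribWord m = 0 → cut^[k] (m + 1) = cut^[k] m + tribNum (k + 2)) ∧
    (tribWord m = 1 → cut^[k] (m + 1) = cut^[k] m + (tribNum (k + 1) + tribNum k)) ∧
    (tribWord m = 2 → cut^[k] (m + 1) = cut^[k] m + tribNum (k + 1)) := by
  induction k with
  | zero => intro m; simp [tribNum]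
  | succ k ih =>
    intro m
    simp only [Function.iterate_succ_apply, cut_succ]
    have h0 := (ih (cut m)).1 (tribWord_cut m)
    have h1 := tribWord_cut_succ m
    refine ⟨fun hm => ?_, fun hm => ?_, fun hm => ?_⟩
    · have h2 := (ih (cut m + 1)).2.1 (by rw [h1, hm]; rfl)
      rw [if_neg (by rw [hm]; decide), show cut m + 2 = cut m + 1 + 1 from rfl, h2, h0,
        show k + 1 + 2 = k + 3 from rfl, tribNum, show k + 1 + 1 = k + 2 from rfl]
      omega
    · have h2 := (ih (cut m + 1)).2.2 (by rw [h1, hm]; rfl)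
      rw [if_neg (by rw [hm]; decide), show cut m + 2 = cut m + 1 + 1 from rfl, h2, h0,
        show k + 1 + 1 = k + 2 from rfl]
      omega
    · rw [if_pos hm, h0]

theorem tribNum_le_succ (n : ℕ) : tribNum n ≤ tribNum (n + 1) := by
  match n with
  | 0 => simp [tribNum]
  | 1 => simp [tribNum]
  | n + 2 => rw [show n + 2 + 1 = n + 3 from rfl, tribNum]; omega

theorem tribNum_mono : Monotone tribNum := monotone_nat_of_le_succ tribNum_le_succ

theorem tribNum_pos {n : ℕ} (hn : 1 ≤ n) : 0 < tribNum n :=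
  lt_of_lt_of_le (by simp [tribNum]) (tribNum_mono hn)

theorem tribNum_lt_succ {n : ℕ} (hn : 2 ≤ n) : tribNum n < tribNum (n + 1) := by
  obtain ⟨m, rfl⟩ := Nat.exists_eq_add_of_le' hn
  rw [show m + 2 + 1 = m + 3 from rfl, tribNum]
  have := tribNum_pos (show 1 ≤ m + 1 by omega)
  omega

theorem cut_iterate_add_le (k m : ℕ) : cut^[k] m + tribNum (k + 1) ≤ cut^[k] (m + 1) := by
  obtain ⟨h0, h1, h2⟩ := cut_iterate_succ k m
  have hk : tribNum (k + 1) ≤ tribNum (k + 2) := tribNum_le_succ (k + 1)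
  generalize tribWord m = a at *
  fin_cases a
  · have := h0 rfl; omega
  · have := h1 rfl; omega
  · have := h2 rfl; omega

/-! ### Repetitions -/

/-- The blocks of length `r` at positions `i` and `j` coincide. -/
def Agree (i j r : ℕ) : Prop := ∀ k < r, tribWord (i + k) = tribWord (j + k)

theorem Agree.cut_add {i j r : ℕ} (h : Agree i j r) :
    cut (i + r) + cut j = cut (j + r) + cut i := by
  induction r with
  | zero => simp [add_comm]
  | succ r ih =>
    have h1 := ih fun k hk => h k (by omega)
    rw [← add_assoc, ← add_assoc, cut_succ, cut_succ, h r (by omega)]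
    omega

/-- The extra letter is the `0` that opens the image following either block. -/
theorem Agree.image {i j r s : ℕ} (h : Agree i j r) (hs : cut i + s ≤ cut (i + r) + 1) :
    Agree (cut i) (cut j) s := by
  induction r generalizing s with
  | zero =>
    intro k hk
    obtain rfl : k = 0 := by rw [add_zero] at hs; omega
    simp [tribWord_cut]
  | succ r ih =>
    intro k hk
    have h' : Agree i j r := fun k hk => h k (by omega)
    by_cases hk' : cut i + (k + 1) ≤ cut (i + r) + 1
    · exact ih h' hk' k (by omega)
    have hc := h'.cut_add
    have hc' := h.cut_add
    have hcut := cut_succ (i + r)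
    have hr := h r (by omega)
    rw [← add_assoc] at hs hc'
    by_cases hk1 : cut i + k = cut (i + r) + 1
    · rw [hk1, show cut j + k = cut (j + r) + 1 by omega, tribWord_cut_succ, tribWord_cut_succ, hr]
    · have hk2 : cut i + k = cut (i + r + 1) := by split_ifs at hcut <;> omega
      rw [hk2, show cut j + k = cut (j + (r + 1)) by omega, tribWord_cut, tribWord_cut]

/-- Past the common `0`, the next letters are the differing letters plus one, so the lifted
agreement stops exactly there. -/
theorem Agree.image_ne {i j r s : ℕ} (h : Agree i j r)
    (hne : tribWord (i + r) ≠ tribWord (j + r)) (hs : cut i + s = cut (i + r) + 1) :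
    tribWord (cut i + s) ≠ tribWord (cut j + s) := by
  have hc := h.cut_add
  rw [hs, show cut j + s = cut (j + r) + 1 by omega, tribWord_cut_succ, tribWord_cut_succ]
  exact fun h => hne (add_right_cancel h)

/-- If the shifted words at `i` and `j` differ, there is a first difference. -/
theorem exists_agree_ne {i j : ℕ} (h : ∃ k, tribWord (i + k) ≠ tribWord (j + k)) :
    ∃ r, Agree i j r ∧ tribWord (i + r) ≠ tribWord (j + r) := by
  classical
  exact ⟨Nat.find h, fun k hk => not_not.1 (Nat.find_min h hk), Nat.find_spec h⟩

/-- If the shifted words at `cut i` and `cut j` differ, then so do those at `i` and `j`. -/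
theorem exists_ne_of_cut {i j k : ℕ} (h : tribWord (cut i + k) ≠ tribWord (cut j + k)) :
    ∃ r, tribWord (i + r) ≠ tribWord (j + r) := by
  by_contra! hall
  refine h (Agree.image (r := k + 1) (s := k + 1) (fun l _ => hall l) ?_ k (by omega))
  have := cut_add_le i (k + 1)
  omega

/-- The Tribonacci word is not eventually periodic. -/
theorem not_agree_forall (p : ℕ) (hp : 0 < p) (i : ℕ) :
    ∃ k, tribWord (i + k) ≠ tribWord (i + p + k) := by
  induction p using Nat.strong_induction_on generalizing i with
  | _ p ih =>
    by_contra! hall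
    have key : ∀ i, tribWord i = 0 → (∀ k, tribWord (i + k) = tribWord (i + p + k)) → False := by
      intro i hi hall
      obtain ⟨a, rfl⟩ := exists_eq_cut hi
      obtain ⟨b, hb⟩ := exists_eq_cut (j := cut a + p) (by simpa [hi] using (hall 0).symm)
      have hab : a < b := cut_strictMono.lt_iff_lt.1 (by omega)
      by_cases hne : ∃ k, tribWord (a + k) ≠ tribWord (b + k)
      · obtain ⟨r, hr, hr'⟩ := exists_agree_ne hne
        have hs : cut a + (cut (a + r) + 1 - cut a) = cut (a + r) + 1 := by
          have := cut_strictMono.monotone (show a ≤ a + r by omega)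
          omega
        have := hr.image_ne hr' hs
        rw [← hb] at this
        exact this (hall _)
      push Not at hne
      -- Starting at a letter `0`, whose image has two letters, makes the desubstituted period
      -- strictly smaller than `p`.
      obtain ⟨c, hc0, hcp, hce⟩ : ∃ c, tribWord c = 0 ∧ cut (c + (b - a)) = cut c + p ∧
          ∀ k, tribWord (c + k) = tribWord (c + (b - a) + k) := by
        by_cases ha : tribWord a = 0
        · exact ⟨a, ha, by rw [show a + (b - a) = b by omega, hb],
            fun k => by rw [show a + (b - a) = b by omega, hne]⟩
        · refine ⟨a + 1, tribWord_succ ha, ?_, fun k => ?_⟩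
          · have h0 := hne 0
            rw [add_zero, add_zero] at h0
            rw [show a + 1 + (b - a) = b + 1 by omega, cut_succ, cut_succ, h0]
            omega
          · rw [show a + 1 + (b - a) + k = b + (1 + k) by omega, ← hne (1 + k), add_assoc]
      have h1 := cut_succ c
      rw [hc0, if_neg (by decide)] at h1
      have h2 := cut_add_le (c + 1) (b - a - 1)
      rw [show c + 1 + (b - a - 1) = c + (b - a) by omega] at h2
      obtain ⟨k, hk⟩ := ih (b - a) (by omega) (by omega) c
      exact hk (hce k)
    by_cases hi : tribWord i = 0
    · exact key i hi hall
    · refine key (i + 1) (tribWord_succ hi) fun k => ?_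
      rw [add_assoc, hall, show i + 1 + p + k = i + p + (1 + k) by omega]

/-- A repetition that extends neither to the left nor to the right is obtained from an empty
one by `n` desubstitutions, which determines its length and bounds its period below. -/
theorem exists_of_maximal (r : ℕ) : ∀ i j : ℕ, i < j → Agree i j r →
    tribWord (i + r) ≠ tribWord (j + r) →
    (∀ i' j', i = i' + 1 → j = j' + 1 → tribWord i' ≠ tribWord j') →
    ∃ n, ∀ k, cut^[k] (i + r) = cut^[k] i + ∑ m ∈ range n, tribNum (k + m + 2) ∧
      cut^[k] i + tribNum (k + n + 1) ≤ cut^[k] j := by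
  induction r using Nat.strong_induction_on with
  | _ r ih =>
    intro i j hij hag hne hleft
    rcases Nat.eq_zero_or_pos r with rfl | hr
    · refine ⟨0, fun k => ⟨by simp, ?_⟩⟩
      exact (cut_iterate_add_le k i).trans ((cut_strictMono.iterate k).monotone hij)
    have h0 := hag 0 hr
    rw [add_zero, add_zero] at h0
    -- Nonzero letters are always preceded by `0`, so a nonzero first letter would allow an
    -- extension to the left.
    have hi : tribWord i = 0 := by
      by_contra hi
      obtain ⟨i', rfl, hi'⟩ := tribWord_pred hi
      obtain ⟨j', rfl, hj'⟩ := tribWord_pred (h0 ▸ hi)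
      exact hleft i' j' rfl rfl (hi'.trans hj'.symm)
    obtain ⟨a, rfl⟩ := exists_eq_cut hi
    obtain ⟨b, rfl⟩ := exists_eq_cut (h0 ▸ hi)
    obtain ⟨r', hag', hne'⟩ := exists_agree_ne (exists_ne_of_cut hne)
    have hab : a < b := cut_strictMono.lt_iff_lt.1 hij
    have hmono := cut_add_le a r'
    have hs : cut a + (cut (a + r') + 1 - cut a) = cut (a + r') + 1 := by
      omega
    have himg := hag'.image hs.le
    have himg' := hag'.image_ne hne' hs
    -- Both sides are the place of the first disagreement.
    have hrr : r = cut (a + r') + 1 - cut a := by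
      rcases lt_trichotomy r (cut (a + r') + 1 - cut a) with h | h | h
      · exact absurd (himg r h) hne
      · exact h
      · exact absurd (hag _ h) himg'
    obtain ⟨n, hn⟩ := ih r' (by omega) a b hab hag' hne' (by
      rintro a' b' rfl rfl h
      have ha := cut_succ a'
      have hb := cut_succ b'
      rw [← h] at hb
      split_ifs at ha hb with h2
      · exact hleft (cut a') (cut b') ha hb (by rw [tribWord_cut, tribWord_cut])
      · exact hleft (cut a' + 1) (cut b' + 1) ha hb
          (by rw [tribWord_cut_succ, tribWord_cut_succ, h]))
    refine ⟨n + 1, fun k => ?_⟩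
    -- One more image shifts the indices of the sum; the appended `0` supplies the new term `m = 0`.
    obtain ⟨h1, h2⟩ := hn (k + 1)
    simp only [Function.iterate_succ_apply] at h1 h2
    constructor
    · rw [hrr, hs, (cut_iterate_succ k _).1 (tribWord_cut _), h1, sum_range_succ', add_assoc]
      simp only [add_zero, add_left_inj, add_right_inj]
      exact sum_congr rfl fun m _ => by congr 1; omega
    · rwa [show k + (n + 1) + 1 = k + 1 + n + 1 by omega]

/-- A repetition of period `p` can be prolonged by at most as many letters as the longest
bispecial factor one of whose return words has length at most `p`. -/
theorem Agree.exists_le {i p r : ℕ} (hp : 0 < p) (h : Agree i (i + p) r) :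
    ∃ n, r ≤ ∑ m ∈ range n, tribNum (m + 2) ∧ tribNum (n + 1) ≤ p := by
  induction i generalizing r with
  | zero =>
    obtain ⟨s, hs, hs'⟩ := exists_agree_ne (not_agree_forall p hp 0)
    have hrs : r ≤ s := by
      by_contra! hlt
      exact hs' (h s hlt)
    obtain ⟨n, hn⟩ := exists_of_maximal s 0 (0 + p) (by omega) hs hs' (fun _ _ h => by omega)
    have := hn 0
    simp only [Function.iterate_zero, id, zero_add] at this
    exact ⟨n, by omega, this.2⟩
  | succ i ih =>
    -- Extend to the left while possible; aperiodicity bounds the extension to the right.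
    by_cases hi : tribWord i = tribWord (i + p)
    · obtain ⟨n, hn, hn'⟩ := ih (r := r + 1) (fun k hk => by
        rcases k with _ | k
        · exact hi
        · have := h k (by omega)
          rwa [show i + (k + 1) = i + 1 + k by omega,
            show i + p + (k + 1) = i + 1 + p + k by omega])
      exact ⟨n, by omega, hn'⟩
    obtain ⟨s, hs, hs'⟩ := exists_agree_ne (not_agree_forall p hp (i + 1))
    have hrs : r ≤ s := by
      by_contra! hlt
      exact hs' (h s hlt)
    obtain ⟨n, hn⟩ := exists_of_maximal s (i + 1) (i + 1 + p) (by omega) hs hs' (by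
      intro i' j' h1 h2
      obtain rfl : i = i' := by omega
      obtain rfl : i + p = j' := by omega
      exact hi)
    have := hn 0
    simp only [Function.iterate_zero, id, zero_add] at this
    exact ⟨n, by omega, by omega⟩

/-- Position 3 carries the letter `2`, whose `n`-fold image has the minimal length `T_{n+1}`; the
empty agreement at 3 and 4 is lifted `n` times. -/
theorem exists_agree_iterate (n : ℕ) : ∃ r, Agree (cut^[n] 3) (cut^[n] 4) r ∧
    ∀ k, cut^[k] (cut^[n] 3 + r) = cut^[k] (cut^[n] 3) + ∑ m ∈ range n, tribNum (k + m + 2) := by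
  induction n with
  | zero => exact ⟨0, fun k hk => absurd hk (by omega), by simp⟩
  | succ n ih =>
    obtain ⟨r, hr, hk⟩ := ih
    have hmono := cut_strictMono.monotone (show cut^[n] 3 ≤ cut^[n] 3 + r by omega)
    have hs : cut (cut^[n] 3) + (cut (cut^[n] 3 + r) + 1 - cut (cut^[n] 3)) =
      cut (cut^[n] 3 + r) + 1 := by omega
    rw [Function.iterate_succ_apply', Function.iterate_succ_apply']
    refine ⟨_, hr.image hs.le, fun k => ?_⟩
    have h1 := hk (k + 1)
    simp only [Function.iterate_succ_apply] at h1
    rw [hs, (cut_iterate_succ k _).1 (tribWord_cut _), h1, sum_range_succ', add_assoc]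
    simp only [add_zero, add_left_inj, add_right_inj]
    exact sum_congr rfl fun m _ => by congr 1; omega

theorem exists_agree_tribNum (n : ℕ) :
    ∃ i, Agree i (i + tribNum (n + 1)) (∑ m ∈ range n, tribNum (m + 2)) := by
  obtain ⟨r, hr, hk⟩ := exists_agree_iterate n
  have h0 := hk 0
  simp only [Function.iterate_zero, id, zero_add] at h0
  have h3 := (cut_iterate_succ n 3).2.2 (by decide)
  rw [h3, Nat.add_left_cancel h0] at hr
  exact ⟨_, hr⟩

/-! ### Factors and periods -/

theorem IsFactor.exists_agree {w : List (Fin 3)} {p : ℕ} (hw : IsFactor w tribWord)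
    (hp : HasPeriod w p) : ∃ i, Agree i (i + p) (w.length - p) := by
  obtain ⟨i, n, rfl⟩ := hw
  refine ⟨i, fun k hk => ?_⟩
  have := hp.2 k (by omega)
  simp only [List.getElem_ofFn] at this
  rw [this, add_assoc, add_comm p k]

theorem Agree.exists_factor {i p r : ℕ} (hp : 0 < p) (h : Agree i (i + p) r) :
    ∃ w : List (Fin 3), IsFactor w tribWord ∧ HasPeriod w p ∧ w.length = p + r := by
  refine ⟨_, ⟨i, p + r, rfl⟩, ⟨hp, fun k hk => ?_⟩, by simp⟩
  simp only [List.length_ofFn] at hk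
  simp only [List.getElem_ofFn]
  rw [h k (by omega), add_assoc, add_comm p k]

/-- The length of the longest factor of the Tribonacci word with period `T_j`. -/
def maxLength (j : ℕ) : ℕ := tribNum j + ∑ m ∈ range (j - 1), tribNum (m + 2)

theorem isGreatest_maxLength {j : ℕ} (hj : 2 ≤ j) :
    IsGreatest {n : ℕ | ∃ w : List (Fin 3),
      IsFactor w tribWord ∧ HasPeriod w (tribNum j) ∧ w.length = n} (maxLength j) := by
  have hpos := tribNum_pos (show 1 ≤ j by omega)
  constructor
  · obtain ⟨i, hi⟩ := exists_agree_tribNum (j - 1)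
    rw [show j - 1 + 1 = j by omega] at hi
    exact hi.exists_factor hpos
  · rintro _ ⟨w, hw, hp, rfl⟩
    obtain ⟨i, hi⟩ := hw.exists_agree hp
    obtain ⟨n, hn, hn'⟩ := hi.exists_le hpos
    have hnj : n ≤ j - 1 := by
      by_contra! hlt
      have h1 := tribNum_lt_succ hj
      have h2 := tribNum_mono (show j + 1 ≤ n + 1 by omega)
      omega
    have hsum : ∑ m ∈ range n, tribNum (m + 2) ≤ ∑ m ∈ range (j - 1), tribNum (m + 2) :=
      sum_le_sum_of_subset (range_subset_range.2 hnj)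
    rw [maxLength]
    omega

theorem two_mul_sum_tribNum (n : ℕ) :
    2 * ∑ m ∈ range n, tribNum (m + 2) + 3 = tribNum (n + 3) + tribNum (n + 1) := by
  induction n with
  | zero => simp [tribNum]
  | succ n ih =>
    rw [sum_range_succ, show n + 1 + 3 = (n + 1) + 3 from rfl, tribNum,
      show n + 1 + 1 = n + 2 from rfl, show n + 1 + 2 = n + 3 from rfl]
    omega

theorem two_mul_maxLength {j : ℕ} (hj : 1 ≤ j) :
    2 * maxLength j + 3 = tribNum (j + 2) + 3 * tribNum j := by
  have := two_mul_sum_tribNum (j - 1)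
  rw [show j - 1 + 3 = j + 2 by omega, show j - 1 + 1 = j by omega] at this
  rw [maxLength]
  omega

theorem maxLength_eq {j : ℕ} (hj : 2 ≤ j) :
    (maxLength j : ℝ) = 5 / 2 * (tribNum j : ℝ) + (tribNum (j - 1) : ℝ)
      + 1 / 2 * (tribNum (j - 2) : ℝ) - 3 / 2 := by
  have h := two_mul_maxLength (show 1 ≤ j by omega)
  obtain ⟨m, rfl⟩ := Nat.exists_eq_add_of_le' hj
  rw [show m + 2 + 2 = (m + 1) + 3 from rfl, tribNum, show m + 1 + 2 = m + 3 from rfl, tribNum,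
    show m + 1 + 1 = m + 2 from rfl] at h
  have h' : (2 * maxLength (m + 2) + 3 : ℝ) = tribNum (m + 2) + tribNum (m + 1) + tribNum m +
      tribNum (m + 2) + tribNum (m + 1) + 3 * tribNum (m + 2) := by exact_mod_cast h
  simp only [Nat.add_sub_cancel, show m + 2 - 1 = m + 1 by omega]
  linarith

/-! ### Growth of the Tribonacci numbers -/

theorem exists_root : ∃ τ : ℝ, 1.83 < τ ∧ τ < 1.84 ∧ τ ^ 3 = τ ^ 2 + τ + 1 := by
  have hc : ContinuousOn (fun x : ℝ => x ^ 3 - x ^ 2 - x - 1) (Set.Icc 1.83 1.84) := by fun_prop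
  obtain ⟨τ, hτ, h⟩ := intermediate_value_Ioo (by norm_num) hc
    (show (0 : ℝ) ∈ Set.Ioo _ _ by constructor <;> norm_num)
  exact ⟨τ, hτ.1, hτ.2, by simp only at h; linarith⟩

/-- The differences `T_{n+1} - τ T_n` obey the recurrence with polynomial `X² + (τ - 1) X + (τ² - τ
- 1)`, the cofactor of `X - τ` in `X³ - X² - X - 1`. Its norm form is multiplied by `τ² - τ - 1 ≤ 1`
at each step. -/
theorem norm_form_le {τ : ℝ} (h1 : 1.83 < τ) (h2 : τ < 1.84) (h3 : τ ^ 3 = τ ^ 2 + τ + 1)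
    (n : ℕ) :
    ((tribNum (n + 2) : ℝ) - τ * tribNum (n + 1)) ^ 2 +
      (τ - 1) * (tribNum (n + 2) - τ * tribNum (n + 1)) * (tribNum (n + 1) - τ * tribNum n) +
      (τ ^ 2 - τ - 1) * (tribNum (n + 1) - τ * tribNum n) ^ 2 ≤ τ ^ 2 - τ - 1 := by
  have hc0 : 0 ≤ τ ^ 2 - τ - 1 := by nlinarith
  have hc1 : τ ^ 2 - τ - 1 ≤ 1 := by nlinarith
  induction n with
  | zero => simp only [tribNum]; push_cast; nlinarith
  | succ n ih =>
    have hrec : (tribNum (n + 1 + 2) : ℝ) = tribNum (n + 2) + tribNum (n + 1) + tribNum n := by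
      rw [show n + 1 + 2 = n + 3 from rfl, tribNum]; push_cast; ring
    rw [hrec, show n + 1 + 1 = n + 2 from rfl]
    set a : ℝ := (tribNum (n + 2) : ℝ)
    set b : ℝ := (tribNum (n + 1) : ℝ)
    set c : ℝ := (tribNum n : ℝ)
    have hd : a + b + c - τ * a =
        -(τ - 1) * (a - τ * b) - (τ ^ 2 - τ - 1) * (b - τ * c) := by linear_combination -c * h3
    rw [hd]
    have := mul_le_mul_of_nonneg_left ih hc0
    nlinarith [mul_le_mul_of_nonneg_left hc1 hc0]

theorem abs_tribNum_sub_le {τ : ℝ} (h1 : 1.83 < τ) (h2 : τ < 1.84) (h3 : τ ^ 3 = τ ^ 2 + τ + 1)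
    (n : ℕ) : |(tribNum (n + 2) : ℝ) - τ ^ 2 * tribNum n| ≤ 3 := by
  have hQ := norm_form_le h1 h2 h3 n
  set x : ℝ := tribNum (n + 2) - τ * tribNum (n + 1)
  set y : ℝ := tribNum (n + 1) - τ * tribNum n
  have hxy : (tribNum (n + 2) : ℝ) - τ ^ 2 * tribNum n = x + τ * y := by simp only [x, y]; ring
  rw [hxy]
  refine abs_le_of_sq_le_sq ?_ (by norm_num)
  have hc : τ ^ 2 - τ - 1 ≤ 0.55 := by nlinarith
  have hc' : 0.51 ≤ τ ^ 2 - τ - 1 := by nlinarith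
  -- The factor 12 is large enough for the difference to be nonnegative, yet `12 * 0.55 < 9`.
  have key : (x + τ * y) ^ 2 ≤
      12 * (x ^ 2 + (τ - 1) * x * y + (τ ^ 2 - τ - 1) * y ^ 2) := by
    have hb : (10 * τ - 12) ^ 2 ≤ 50 := by nlinarith
    have he : 12 * (x ^ 2 + (τ - 1) * x * y + (τ ^ 2 - τ - 1) * y ^ 2) - (x + τ * y) ^ 2 =
        11 * x ^ 2 + (10 * τ - 12) * (x * y) + (12 * (τ ^ 2 - τ - 1) - τ ^ 2) * y ^ 2 := by ring
    have hy : 0 ≤ (12 * (τ ^ 2 - τ - 1) - τ ^ 2 - 2) * y ^ 2 :=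
      mul_nonneg (by nlinarith) (sq_nonneg _)
    have hb' := mul_le_mul_of_nonneg_right hb (sq_nonneg y)
    nlinarith [sq_nonneg (22 * x + (10 * τ - 12) * y), sq_nonneg y]
  linarith

theorem le_tribNum (n : ℕ) : n ≤ tribNum (n + 1) := by
  induction n with
  | zero => simp
  | succ n ih =>
    rcases Nat.eq_zero_or_pos n with rfl | hn
    · simp [tribNum]
    · have := tribNum_lt_succ (show 2 ≤ n + 1 by omega)
      omega

/-- The lengths `maxLength j` are within a bounded distance below `(3 + τ ^ 2) / 2 * T_j`. -/
theorem maxLength_bounds {τ : ℝ} (h1 : 1.83 < τ) (h2 : τ < 1.84) (h3 : τ ^ 3 = τ ^ 2 + τ + 1)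
    {j : ℕ} (hj : 1 ≤ j) :
    (3 + τ ^ 2) / 2 * tribNum j - 3 ≤ maxLength j ∧
      (maxLength j : ℝ) ≤ (3 + τ ^ 2) / 2 * tribNum j := by
  have h : (2 * maxLength j + 3 : ℝ) = tribNum (j + 2) + 3 * tribNum j := by
    exact_mod_cast two_mul_maxLength hj
  have habs := abs_le.1 (abs_tribNum_sub_le h1 h2 h3 j)
  constructor <;> linarith [habs.1, habs.2]

theorem tendsto_maxLength_div {τ : ℝ} (h1 : 1.83 < τ) (h2 : τ < 1.84)
    (h3 : τ ^ 3 = τ ^ 2 + τ + 1) :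
    Tendsto (fun j : ℕ => (maxLength j : ℝ) / (tribNum j : ℝ)) atTop (𝓝 ((3 + τ ^ 2) / 2)) := by
  have htop : Tendsto (fun j : ℕ => (tribNum j : ℝ)) atTop atTop := by
    refine tendsto_natCast_atTop_atTop.comp ((tendsto_add_atTop_iff_nat 1).1 ?_)
    exact tendsto_atTop_mono le_tribNum tendsto_id
  have hlow : Tendsto (fun j : ℕ => (3 + τ ^ 2) / 2 - 3 / (tribNum j : ℝ)) atTop
      (𝓝 ((3 + τ ^ 2) / 2)) := by
    simpa using tendsto_const_nhds.sub (htop.const_div_atTop 3)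
  refine tendsto_of_tendsto_of_tendsto_of_le_of_le' hlow tendsto_const_nhds ?_ ?_ <;>
    filter_upwards [eventually_ge_atTop 1] with j hj
  all_goals
    have hpos : (0 : ℝ) < tribNum j := by exact_mod_cast tribNum_pos hj
    obtain ⟨ha, hb⟩ := maxLength_bounds h1 h2 h3 hj
  · rw [le_div_iff₀ hpos, sub_mul, div_mul_cancel₀ _ hpos.ne']
    exact ha
  · rwa [div_le_iff₀ hpos]

/-! ### The critical exponent -/

theorem smallestPeriod_spec {A : Type*} (w : List A) : HasPeriod w (smallestPeriod w) := by
  classical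
  exact Nat.find_spec (exists_hasPeriod w)

theorem smallestPeriod_le {A : Type*} {w : List A} {p : ℕ} (h : HasPeriod w p) :
    smallestPeriod w ≤ p := by
  classical
  exact Nat.find_min' (exists_hasPeriod w) h

/-- Since `T_{n+1} ≤ p`, the exponent is at most `1 + r / T_{n+1}`, which the bound on `maxLength (n
+ 1)` controls. -/
theorem exponent_le {τ : ℝ} (h1 : 1.83 < τ) (h2 : τ < 1.84) (h3 : τ ^ 3 = τ ^ 2 + τ + 1)
    {w : List (Fin 3)} (hw : IsFactor w tribWord) : exponent w ≤ (3 + τ ^ 2) / 2 := by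
  have hp := smallestPeriod_spec w
  obtain ⟨i, hi⟩ := hw.exists_agree hp
  obtain ⟨n, hn, hn'⟩ := hi.exists_le hp.1
  rw [exponent]
  set p := smallestPeriod w
  have hp0 : (0 : ℝ) < p := by exact_mod_cast hp.1
  rw [div_le_iff₀ hp0]
  have hb := (maxLength_bounds h1 h2 h3 (show 1 ≤ n + 1 by omega)).2
  rw [maxLength, Nat.add_sub_cancel] at hb
  have hlen : (w.length : ℝ) ≤ p + ∑ m ∈ range n, tribNum (m + 2) := by
    exact_mod_cast (by omega : w.length ≤ p + ∑ m ∈ range n, tribNum (m + 2))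
  have hTp : (tribNum (n + 1) : ℝ) ≤ p := by exact_mod_cast hn'
  rw [Nat.cast_add] at hb
  have hpos : 0 ≤ (3 + τ ^ 2) / 2 - 1 := by nlinarith
  have := mul_le_mul_of_nonneg_left hTp hpos
  push_cast at hb hlen
  linarith

theorem criticalExponent_tribWord {τ : ℝ} (h1 : 1.83 < τ) (h2 : τ < 1.84)
    (h3 : τ ^ 3 = τ ^ 2 + τ + 1) :
    criticalExponent tribWord = (((3 + τ ^ 2) / 2 : ℝ) : EReal) := by
  apply le_antisymm
  · refine sSup_le ?_
    rintro _ ⟨w, hw, rfl⟩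
    exact EReal.coe_le_coe_iff.2 (exponent_le h1 h2 h3 hw)
  -- A period `T_j` need not be smallest, but a smaller one only raises the exponent.
  · refine le_of_tendsto (continuous_coe_real_ereal.continuousAt.tendsto.comp
      (tendsto_maxLength_div h1 h2 h3)) ?_
    filter_upwards [eventually_ge_atTop 2] with j hj
    obtain ⟨w, hw, hp, hlen⟩ := (isGreatest_maxLength hj).1
    refine le_trans ?_ (le_sSup ⟨w, hw, rfl⟩)
    refine EReal.coe_le_coe_iff.2 ?_
    rw [exponent, hlen]
    have := (smallestPeriod_spec w).1
    have := smallestPeriod_le hp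
    change (maxLength j : ℝ) / tribNum j ≤ _
    gcongr

/-! ### The cubic -/

theorem cubic_eq_zero {τ : ℝ} (h3 : τ ^ 3 = τ ^ 2 + τ + 1) :
    2 * ((3 + τ ^ 2) / 2) ^ 3 - 12 * ((3 + τ ^ 2) / 2) ^ 2 + 22 * ((3 + τ ^ 2) / 2) - 13 = 0 := by
  linear_combination 1 / 4 * (τ ^ 3 + τ ^ 2 - τ + 1) * h3

/-- With `u = x - 2` the cubic is `2 (u³ - u) - 1`, increasing for `u ≥ 1`. -/
theorem cubic_strictMono {x y : ℝ} (hx : 3 ≤ x) (hxy : x < y) :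
    2 * x ^ 3 - 12 * x ^ 2 + 22 * x - 13 < 2 * y ^ 3 - 12 * y ^ 2 + 22 * y - 13 := by
  have h : 0 < (x - 2) ^ 2 + (x - 2) * (y - 2) + (y - 2) ^ 2 - 1 := by nlinarith
  nlinarith [mul_pos (sub_pos.2 hxy) h]

/-- For `u = x - 2 ≤ 1`, `u³ - u` stays below `1/2`. -/
theorem three_lt_of_cubic {x : ℝ} (hx : 2 * x ^ 3 - 12 * x ^ 2 + 22 * x - 13 = 0) : 3 < x := by
  by_contra! h
  nlinarith [mul_nonneg (sub_nonneg.2 h) (sq_nonneg (x - 2 + 1 / 2)), sq_nonneg (x - 1),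
    mul_nonneg (sub_nonneg.2 h) (sq_nonneg (x - 1)), sq_nonneg (x - 3 / 2)]

theorem lt_of_cubic_lt {x y : ℝ} (hx : 3 ≤ x) (hy : 3 ≤ y)
    (h : 2 * x ^ 3 - 12 * x ^ 2 + 22 * x - 13 < 2 * y ^ 3 - 12 * y ^ 2 + 22 * y - 13) : x < y := by
  by_contra! hle
  rcases hle.eq_or_lt with rfl | hlt
  · exact lt_irrefl _ h
  · exact lt_asymm h (cubic_strictMono hy hlt)

end Tribonacci

open Tribonacci in
theorem theorem16 :
    ∃ ρ : ℝ,
      (∀ x : ℝ, 2 * x ^ 3 - 12 * x ^ 2 + 22 * x - 13 = 0 ↔ x = ρ) ∧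
      |ρ - 3.19148788395311874706| < 10 ^ (-20 : ℤ) / 2 ∧
      criticalExponent tribWord = (ρ : EReal) ∧
      ∃ U : ℕ → ℕ,
        (∀ j : ℕ, 2 ≤ j →
          IsGreatest {n : ℕ | ∃ w : List (Fin 3),
            IsFactor w tribWord ∧ HasPeriod w (tribNum j) ∧ w.length = n} (U j) ∧
          (U j : ℝ) = 5 / 2 * (tribNum j : ℝ) + (tribNum (j - 1) : ℝ)
            + 1 / 2 * (tribNum (j - 2) : ℝ) - 3 / 2) ∧
        Tendsto (fun j : ℕ => (U j : ℝ) / (tribNum j : ℝ)) atTop (𝓝 ρ) := by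
  obtain ⟨τ, h1, h2, h3⟩ := exists_root
  have hcubic := cubic_eq_zero h3
  have hρ := three_lt_of_cubic hcubic
  refine ⟨(3 + τ ^ 2) / 2, fun x => ⟨fun hx => ?_, fun hx => hx ▸ hcubic⟩, ?_,
    criticalExponent_tribWord h1 h2 h3, maxLength,
    fun j hj => ⟨isGreatest_maxLength hj, maxLength_eq hj⟩, tendsto_maxLength_div h1 h2 h3⟩
  · have hx3 := three_lt_of_cubic hx
    rcases lt_trichotomy x ((3 + τ ^ 2) / 2) with h | h | h
    · linarith [cubic_strictMono hx3.le h]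
    · exact h
    · linarith [cubic_strictMono hρ.le h]
  · generalize (3 + τ ^ 2) / 2 = ρ at hcubic hρ
    rw [abs_sub_lt_iff]
    constructor
    · rw [sub_lt_iff_lt_add]
      refine lt_of_cubic_lt hρ.le (by norm_num) ?_
      rw [hcubic]
      norm_num
    · rw [sub_lt_comm]
      refine lt_of_cubic_lt (by norm_num) hρ.le ?_
      rw [hcubic]
      norm_num
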